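/- Let $n\ge 2$. For $x\in\mathbb{C}^n$ write $x\cdot x=\sum_j x_j^2$, $\langle\theta,x\rangle=\sum_j\theta_jx_j$ for $\theta\in\mathbb{S}^{n-1}\subset\mathbb{R}^n$, $\|x\|^2=\sum_j|x_j|^2$, and let $$L(x)=\Big(\|x\|^2+\sqrt{\|x\|^4-|x\cdot x|^2}\Big)^{1/2}$$ be the Lie norm, whose open unit ball is the Lie ball (Cartan's fourth domain). For $\zeta\in\mathbb{C}$ with $|\zeta|>L(x)$ put $$r(\zeta\theta-x)=\zeta\Big(1-\frac{2\langle\theta,x\rangle}{\zeta}+\frac{x\cdot x}{\zeta^2}\Big)^{1/2}$$ with the principal square root, so that $r(\zeta\theta-x)^2=\zeta^2-2\zeta\langle\theta,x\rangle+x\cdot x$ and $r(\zeta\theta)=\zeta$. Then $r(\zeta\theta-x)$ is continuous in $(\zeta,\theta,x)$ and has no zeros on the set $\{|\zeta|>L(x)\}$, and for every polynomial $P$ on $\mathbb{C}^n$ with complex coefficients, every $x\in\mathbb{C}^n$ and every $R>L(x)$, $$P(x)=\frac{1}{2\pi i}\oint_{|\zeta|=R}\int_{\mathbb{S}^{n-1}}\frac{\zeta^{n-1}}{r(\zeta\theta-x)^n}\,P(\zeta\theta)\,d\theta\,d\zeta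 ,$$ where $d\theta$ is the rotation-invariant surface measure on $\mathbb{S}^{n-1}$ of total mass $1$. In particular ($R=1$), for all $x$ in the Lie ball the formula holds with the integral over $\mathbb{S}^1\times\mathbb{S}^{n-1}$. -/

import Mathlib

open MeasureTheory

noncomputable section

/-- The real unit sphere `𝕊^{n-1}` of `ℝⁿ`. -/
abbrev RealSphere (n : ℕ) : Type := Metric.sphere (0 : EuclideanSpace ℝ (Fin n)) 1

/-- The complex bilinear extension `x · x = ∑ xⱼ²` to `ℂⁿ` of the function `|x|²` on `ℝⁿ`. -/
def bilinSq {n : ℕ} (x : EuclideanSpace ℂ (Fin n)) : ℂ := ∑ j, x j ^ 2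

/-- The scalar product `⟨θ, x⟩ = ∑ θⱼ xⱼ` of a real unit vector `θ` and `x ∈ ℂⁿ`. -/
def realPairing {n : ℕ} (θ : RealSphere n) (x : EuclideanSpace ℂ (Fin n)) : ℂ :=
  ∑ j, (θ.1 j : ℂ) * x j

/-- The Lie norm `L(x) = (‖x‖² + (‖x‖⁴ - |x · x|²)^{1/2})^{1/2}` on `ℂⁿ`. Its open unit ball
is the Lie ball (the fourth domain of Cartan). -/
def lieNorm {n : ℕ} (x : EuclideanSpace ℂ (Fin n)) : ℝ :=
  Real.sqrt (‖x‖ ^ 2 + Real.sqrt (‖x‖ ^ 4 - ‖bilinSq x‖ ^ 2))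

/-- The root `r(ζθ - x)` of `ζ² - 2ζ⟨θ, x⟩ + x · x`, written as
`ζ (1 - 2ζ⁻¹⟨θ, x⟩ + ζ⁻² x · x)^{1/2}` with the principal square root (used for `ζ ≠ 0`).
This is the branch that equals `ζ` at `x = 0`. -/
def aronszajnRoot {n : ℕ} (ζ : ℂ) (θ : RealSphere n) (x : EuclideanSpace ℂ (Fin n)) : ℂ :=
  ζ * (1 - 2 * realPairing θ x / ζ + bilinSq x / ζ ^ 2) ^ (1 / 2 : ℂ)

/-- The Hua–Aronszajn kernel `ζ^{n-1} / r(ζθ - x)^n`. -/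
def huaAronszajnKernel {n : ℕ} (ζ : ℂ) (θ : RealSphere n) (x : EuclideanSpace ℂ (Fin n)) : ℂ :=
  ζ ^ (n - 1) / aronszajnRoot ζ θ x ^ n

theorem aronszajnRoot_sq {n : ℕ} {ζ : ℂ} (hζ : ζ ≠ 0) (θ : RealSphere n)
    (x : EuclideanSpace ℂ (Fin n)) :
    aronszajnRoot ζ θ x ^ 2 = ζ ^ 2 - 2 * ζ * realPairing θ x + bilinSq x := by
  have h (w : ℂ) : (w ^ (1 / 2 : ℂ)) ^ 2 = w := by
    rw [← Complex.cpow_nat_mul]; norm_num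
  rw [aronszajnRoot, mul_pow, h]
  field_simp

theorem aronszajnRoot_zero {n : ℕ} (ζ : ℂ) (θ : RealSphere n) :
    aronszajnRoot ζ θ 0 = ζ := by
  simp [aronszajnRoot, realPairing, bilinSq]

end

/-!
The roots `z`, `w` of `ζ² - 2ζ⟨θ, x⟩ + x · x` in `ζ` satisfy `|z|, |w| ≤ L(x)`, so for `|ζ| > L(x)`
the radicand `(1 - z / ζ) (1 - w / ζ)` is a product of two numbers of positive real part and avoids
the branch cut of the square root.

By the binomial series, `ζ ^ (n - 1) / r(ζθ - x) ^ n = ζ⁻¹ (1 - D(ζ⁻¹)) ^ (-n / 2)`, where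
`D(t) = 2⟨θ, x⟩ t - (x · x) t²`, is the generating function `∑ Gₖ(θ) ζ ^ (-k - 1)` of the Gegenbauer
polynomials `Gₖ` of order `n / 2`. Hence the circle integral pairs the component of degree `k` of
`P` with `Gₖ`, and the formula says that `Gₖ` reproduces the homogeneous polynomials of degree `k`
on the sphere. The generating function `exp (D(t))` of the Hermite polynomials has the analogous
property for the Gaussian weight, by integration by parts. In polar coordinates the Gaussian
integral of the coefficient of `tᵏ` in `D(t) ^ m / m!` times a homogeneous polynomial of degree `k`
is `Γ(n / 2 + m) / (Γ(n / 2) m!) = binom(n / 2 + m - 1, m)` times its spherical average, up to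
normalization, and these factors turn the exponential series into the binomial series.
-/

noncomputable section

namespace HuaAronszajn

section Root

variable {n : ℕ}

theorem mul_mem_slitPlane_of_re_pos {a b : ℂ} (ha : 0 < a.re) (hb : 0 < b.re) :
    a * b ∈ Complex.slitPlane := by
  rw [Complex.mem_slitPlane_iff, Complex.mul_re, Complex.mul_im]
  by_contra! h
  obtain ⟨hre, him⟩ := h
  have hscaled : b.re * (a.re * b.re - a.im * b.im) = a.re * (b.re ^ 2 + b.im ^ 2) := by
    linear_combination (-b.im) * him
  have : 0 < a.re * (b.re ^ 2 + b.im ^ 2) := by positivity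
  linarith [mul_nonpos_of_nonneg_of_nonpos hb.le hre]

theorem re_one_sub_pos {z : ℂ} (hz : ‖z‖ < 1) : 0 < (1 - z).re := by
  rw [Complex.sub_re, Complex.one_re]
  linarith [Complex.re_le_norm z]

theorem norm_bilinSq_le (x : EuclideanSpace ℂ (Fin n)) : ‖bilinSq x‖ ≤ ‖x‖ ^ 2 := by
  rw [EuclideanSpace.norm_sq_eq]
  exact norm_sum_le_of_le _ fun j _ => (norm_pow _ _).le

/-- The real unit vector `θ` regarded as an element of `ℂⁿ`. -/
def complexify (θ : RealSphere n) : EuclideanSpace ℂ (Fin n) := WithLp.toLp 2 fun j => (θ.1 j : ℂ)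

theorem inner_complexify (θ : RealSphere n) (x : EuclideanSpace ℂ (Fin n)) :
    inner ℂ (complexify θ) x = realPairing θ x := by
  simp [complexify, realPairing, PiLp.inner_apply, mul_comm]

theorem bilinSq_complexify (θ : RealSphere n) : bilinSq (complexify θ) = 1 := by
  have h : ∑ j, θ.1 j ^ 2 = 1 := by
    rw [← EuclideanSpace.real_norm_sq_eq, norm_eq_of_mem_sphere, one_pow]
  simpa [bilinSq, complexify] using congrArg Complex.ofReal h

theorem norm_complexify (θ : RealSphere n) : ‖complexify θ‖ = 1 := by
  rw [← norm_eq_of_mem_sphere θ, EuclideanSpace.norm_eq, EuclideanSpace.norm_eq]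
  simp [complexify]

theorem bilinSq_sub_smul_complexify (c : ℂ) (θ : RealSphere n) (x : EuclideanSpace ℂ (Fin n)) :
    bilinSq (x - c • complexify θ) = bilinSq x - 2 * c * realPairing θ x + c ^ 2 := by
  calc bilinSq (x - c • complexify θ)
      = bilinSq x - 2 * c * realPairing θ x + c ^ 2 * bilinSq (complexify θ) := by
        simp only [bilinSq, realPairing, complexify, PiLp.sub_apply, PiLp.smul_apply, smul_eq_mul,
          Finset.mul_sum, ← Finset.sum_sub_distrib, ← Finset.sum_add_distrib]
        exact Finset.sum_congr rfl fun j _ => by ring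
    _ = bilinSq x - 2 * c * realPairing θ x + c ^ 2 := by rw [bilinSq_complexify, mul_one]

theorem norm_sub_realPairing_smul_complexify_sq (θ : RealSphere n) (x : EuclideanSpace ℂ (Fin n)) :
    ‖x - realPairing θ x • complexify θ‖ ^ 2 = ‖x‖ ^ 2 - ‖realPairing θ x‖ ^ 2 := by
  have hinner : inner ℂ x (complexify θ) = starRingEnd ℂ (realPairing θ x) := by
    rw [← inner_complexify, inner_conj_symm]
  rw [norm_sub_sq (𝕜 := ℂ), inner_smul_right, hinner, Complex.mul_conj, norm_smul, norm_complexify,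
    Complex.normSq_eq_norm_sq]
  simp only [RCLike.re_to_complex, Complex.ofReal_re]
  ring

theorem norm_realPairing_sq_add_norm_sub_le (θ : RealSphere n) (x : EuclideanSpace ℂ (Fin n)) :
    ‖realPairing θ x‖ ^ 2 + ‖realPairing θ x ^ 2 - bilinSq x‖ ≤ ‖x‖ ^ 2 := by
  have h := norm_bilinSq_le (x - realPairing θ x • complexify θ)
  rw [bilinSq_sub_smul_complexify, norm_sub_realPairing_smul_complexify_sq] at h
  have hneg : bilinSq x - 2 * realPairing θ x * realPairing θ x + realPairing θ x ^ 2 =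
      -(realPairing θ x ^ 2 - bilinSq x) := by ring
  rw [hneg, norm_neg] at h
  linarith

theorem lieNorm_nonneg (x : EuclideanSpace ℂ (Fin n)) : 0 ≤ lieNorm x := Real.sqrt_nonneg _

theorem norm_le_lieNorm_of_mul_eq_bilinSq {x : EuclideanSpace ℂ (Fin n)} {z w : ℂ}
    (hmul : z * w = bilinSq x) (hadd : ‖z‖ ^ 2 + ‖w‖ ^ 2 ≤ 2 * ‖x‖ ^ 2) : ‖z‖ ≤ lieNorm x := by
  have hsq : (‖z‖ ^ 2 - ‖x‖ ^ 2) ^ 2 ≤ ‖x‖ ^ 4 - ‖bilinSq x‖ ^ 2 := by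
    rw [← hmul, norm_mul]
    linarith [mul_le_mul_of_nonneg_left hadd (sq_nonneg ‖z‖)]
  apply Real.le_sqrt_of_sq_le
  linarith [Real.le_sqrt_of_sq_le hsq]

theorem exists_add_eq_mul_eq_norm_le_lieNorm (θ : RealSphere n) (x : EuclideanSpace ℂ (Fin n)) :
    ∃ z w : ℂ, z + w = 2 * realPairing θ x ∧ z * w = bilinSq x ∧
      ‖z‖ ≤ lieNorm x ∧ ‖w‖ ≤ lieNorm x := by
  set u := realPairing θ x
  obtain ⟨s, hs⟩ := IsAlgClosed.exists_pow_nat_eq (u ^ 2 - bilinSq x) two_pos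
  have hmul : (u + s) * (u - s) = bilinSq x := by linear_combination -hs
  have hadd : ‖u + s‖ ^ 2 + ‖u - s‖ ^ 2 ≤ 2 * ‖x‖ ^ 2 := by
    have h := norm_realPairing_sq_add_norm_sub_le θ x
    rw [← hs, norm_pow] at h
    linarith [parallelogram_law_with_norm ℝ u s]
  exact ⟨u + s, u - s, by ring, hmul, norm_le_lieNorm_of_mul_eq_bilinSq hmul hadd,
    norm_le_lieNorm_of_mul_eq_bilinSq (mul_comm (u + s) _ ▸ hmul) (add_comm (‖u + s‖ ^ 2) _ ▸ hadd)⟩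

theorem ne_zero_of_lieNorm_lt {ζ : ℂ} {x : EuclideanSpace ℂ (Fin n)} (h : lieNorm x < ‖ζ‖) :
    ζ ≠ 0 :=
  norm_pos_iff.1 ((lieNorm_nonneg x).trans_lt h)

theorem radicand_mem_slitPlane {ζ : ℂ} (θ : RealSphere n) {x : EuclideanSpace ℂ (Fin n)}
    (h : lieNorm x < ‖ζ‖) :
    1 - 2 * realPairing θ x / ζ + bilinSq x / ζ ^ 2 ∈ Complex.slitPlane := by
  have hζ : ζ ≠ 0 := ne_zero_of_lieNorm_lt h
  obtain ⟨z, w, hadd, hmul, hz, hw⟩ := exists_add_eq_mul_eq_norm_le_lieNorm θ x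
  have hre {v : ℂ} (hv : ‖v‖ ≤ lieNorm x) : 0 < (1 - v / ζ).re := by
    apply re_one_sub_pos
    rw [norm_div, div_lt_one (norm_pos_iff.2 hζ)]
    exact hv.trans_lt h
  have hfactor : 1 - 2 * realPairing θ x / ζ + bilinSq x / ζ ^ 2 = (1 - z / ζ) * (1 - w / ζ) := by
    rw [← hadd, ← hmul]
    field_simp
    ring
  rw [hfactor]
  exact mul_mem_slitPlane_of_re_pos (hre hz) (hre hw)

theorem aronszajnRoot_ne_zero {ζ : ℂ} (θ : RealSphere n) {x : EuclideanSpace ℂ (Fin n)}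
    (h : lieNorm x < ‖ζ‖) : aronszajnRoot ζ θ x ≠ 0 := by
  refine mul_ne_zero (ne_zero_of_lieNorm_lt h) ?_
  rw [Ne, Complex.cpow_eq_zero_iff]
  exact fun h0 => Complex.slitPlane_ne_zero (radicand_mem_slitPlane θ h) h0.1

theorem continuousOn_aronszajnRoot :
    ContinuousOn (fun p : ℂ × RealSphere n × EuclideanSpace ℂ (Fin n) =>
      aronszajnRoot p.1 p.2.1 p.2.2) {p | lieNorm p.2.2 < ‖p.1‖} := by
  have hζ (p : ℂ × RealSphere n × EuclideanSpace ℂ (Fin n)) (hp : lieNorm p.2.2 < ‖p.1‖) :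
      p.1 ≠ 0 := ne_zero_of_lieNorm_lt hp
  unfold aronszajnRoot
  refine continuousOn_fst.mul (ContinuousOn.cpow_const ?_ fun p hp => radicand_mem_slitPlane _ hp)
  unfold realPairing bilinSq
  exact (continuousOn_const.sub (ContinuousOn.div (by fun_prop) continuousOn_fst hζ)).add
    (ContinuousOn.div (by fun_prop) (by fun_prop) fun p hp => pow_ne_zero 2 (hζ p hp))

theorem huaAronszajnKernel_eq_inv_mul_cpow [NeZero n] {ζ : ℂ} (hζ : ζ ≠ 0) (θ : RealSphere n)
    (x : EuclideanSpace ℂ (Fin n)) : huaAronszajnKernel ζ θ x =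
      ζ⁻¹ * (1 / (1 - 2 * realPairing θ x / ζ + bilinSq x / ζ ^ 2) ^ ((n : ℂ) / 2)) := by
  rw [huaAronszajnKernel, aronszajnRoot, mul_pow, ← Complex.cpow_nat_mul, mul_one_div,
    ← mul_pow_sub_one (NeZero.ne n) ζ]
  field_simp

end Root

section Hermite

open MvPolynomial Finset

variable {σ R : Type*} [Fintype σ] [CommRing R]

/-- The linear form `y ↦ ⟨y, x⟩`. -/
def linearForm (x : σ → R) : MvPolynomial σ R := ∑ j, C (x j) * X j

/-- The derivative `∂ₓ = ∑ xⱼ ∂ⱼ` in the direction `x`. -/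
def dirDeriv (x : σ → R) : Derivation R (MvPolynomial σ R) (MvPolynomial σ R) :=
  ∑ j, x j • pderiv j

theorem dirDeriv_apply (x : σ → R) (p : MvPolynomial σ R) :
    dirDeriv x p = ∑ j, C (x j) * pderiv j p := by
  have h := congrFun (map_sum Derivation.coeFnAddMonoidHom (fun j => x j • pderiv j) univ) p
  rw [Finset.sum_apply] at h
  refine h.trans (sum_congr rfl fun j _ => ?_)
  simp [smul_eq_C_mul]

theorem dirDeriv_X (x : σ → R) (j : σ) : dirDeriv x (X j) = C (x j) := by
  classical
  simp [dirDeriv_apply, pderiv_X, Pi.single_apply]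

theorem dirDeriv_linearForm (x : σ → R) : dirDeriv x (linearForm x) = C (∑ j, x j ^ 2) := by
  simp [linearForm, dirDeriv_X, sq]

theorem dirDeriv_isHomogeneous (x : σ → R) {p : MvPolynomial σ R} {k : ℕ}
    (hp : p.IsHomogeneous (k + 1)) : (dirDeriv x p).IsHomogeneous k := by
  rw [dirDeriv_apply]
  exact IsHomogeneous.sum _ _ _ fun j _ => by simpa using (hp.pderiv (i := j)).C_mul (x j)

theorem eval_dirDeriv_self (x : σ → R) {p : MvPolynomial σ R} {k : ℕ} (hp : p.IsHomogeneous k) :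
    eval x (dirDeriv x p) = k * eval x p := by
  simpa [dirDeriv_apply] using congrArg (eval x) hp.sum_X_mul_pderiv

/-- The polynomial `2⟨y, x⟩ t - (x · x) t²` in `t`, with coefficients that are polynomials in `y`.
It is the exponent in the generating function of the Hermite polynomials, and `1` minus it is the
base of the power in the generating function of the Gegenbauer polynomials. -/
def hermiteExponent (x : σ → R) : Polynomial (MvPolynomial σ R) :=
  Polynomial.C (2 * linearForm x) * Polynomial.X -
    Polynomial.C (C (∑ j, x j ^ 2)) * Polynomial.X ^ 2

theorem coeff_hermiteExponent_pow_eq_zero (x : σ → R) {m k : ℕ} (h : k < m) :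
    (hermiteExponent x ^ m).coeff k = 0 := by
  have hX : Polynomial.X ∣ hermiteExponent x :=
    (dvd_mul_left _ _).sub (dvd_mul_of_dvd_right (dvd_pow_self _ two_ne_zero) _)
  exact Polynomial.X_pow_dvd_iff.1 (pow_dvd_pow_of_dvd hX m) k h

theorem map_eval_hermiteExponent (x v : σ → R) : (hermiteExponent x).map (eval v) =
    Polynomial.C (2 * ∑ j, v j * x j) * Polynomial.X -
      Polynomial.C (∑ j, x j ^ 2) * Polynomial.X ^ 2 := by
  have hlin : eval v (2 * linearForm x) = 2 * ∑ j, v j * x j := by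
    simp [linearForm, mul_comm]
  simp only [hermiteExponent, Polynomial.map_sub, Polynomial.map_mul, Polynomial.map_pow,
    Polynomial.map_C, Polynomial.map_X, hlin, eval_C]

theorem eval_coeff_hermiteExponent_pow (x v : σ → R) (m k : ℕ) :
    eval v ((hermiteExponent x ^ m).coeff k) =
      ((hermiteExponent x).map (eval v) ^ m).coeff k := by
  rw [← Polynomial.map_pow, Polynomial.coeff_map]

theorem pow_mul_eval_mul_coeff_hermiteExponent_pow (x v : σ → R) (c : R) (m k : ℕ) :
    c ^ k * eval (fun j => c * v j) ((hermiteExponent x ^ m).coeff k) =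
      c ^ (2 * m) * eval v ((hermiteExponent x ^ m).coeff k) := by
  have hcomp : ((hermiteExponent x).map (eval fun j => c * v j)).comp
        (Polynomial.C c * Polynomial.X) =
      Polynomial.C (c ^ 2) * (hermiteExponent x).map (eval v) := by
    simp only [map_eval_hermiteExponent, mul_assoc, ← mul_sum, Polynomial.sub_comp,
      Polynomial.mul_comp, Polynomial.C_comp, Polynomial.X_comp, Polynomial.pow_comp, map_mul,
      map_pow]
    ring
  rw [eval_coeff_hermiteExponent_pow, eval_coeff_hermiteExponent_pow, mul_comm,
    ← Polynomial.comp_C_mul_X_coeff, Polynomial.pow_comp, hcomp, mul_pow, ← Polynomial.C_pow,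
    Polynomial.coeff_C_mul, pow_mul]

/-- The Gegenbauer polynomial of order `a` and degree `k`, as a polynomial in `y` depending on `x`:
the coefficient of `tᵏ` in `(1 - 2⟨y, x⟩ t + (x · x) t²) ^ (-a)`. -/
def gegenbauer [BinomialRing R] (a : R) (x : σ → R) (k : ℕ) : MvPolynomial σ R :=
  ∑ m ∈ range (k + 1), Ring.choose (a + m - 1) m • (hermiteExponent x ^ m).coeff k

/-- The derivation `∂/∂t + ∂ₓ` of polynomials in `t` and `y`. -/
def timeAddDirDeriv (x : σ → R) :
    Derivation R (Polynomial (MvPolynomial σ R)) (Polynomial (MvPolynomial σ R)) :=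
  Polynomial.derivative'.restrictScalars R +
    PolynomialModule.equivPolynomialSelf.compDer (dirDeriv x).mapCoeffs

theorem coeff_timeAddDirDeriv (x : σ → R) (p : Polynomial (MvPolynomial σ R)) (k : ℕ) :
    (timeAddDirDeriv x p).coeff k = p.coeff (k + 1) * (k + 1) + dirDeriv x (p.coeff k) := by
  rw [← Polynomial.coeff_derivative]
  rfl

theorem timeAddDirDeriv_hermiteExponent (x : σ → R) :
    timeAddDirDeriv x (hermiteExponent x) = Polynomial.C (2 * linearForm x) := by
  have hlin : dirDeriv x (2 * linearForm x) = 2 * C (∑ j, x j ^ 2) := by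
    rw [two_mul, map_add, dirDeriv_linearForm, two_mul]
  unfold hermiteExponent
  generalize ∑ j, x j ^ 2 = A at *
  ext1 k
  rw [coeff_timeAddDirDeriv]
  rcases k with _ | _ | _ | k <;>
    simp [Polynomial.coeff_C, Polynomial.coeff_X, Polynomial.coeff_X_pow, hlin]
  ring

theorem coeff_succ_hermiteExponent_pow_succ (x : σ → R) (m k : ℕ) :
    (k + 1 : R) • (hermiteExponent x ^ (m + 1)).coeff (k + 1) =
      (2 * (m + 1) : R) • (linearForm x * (hermiteExponent x ^ m).coeff k) -
        dirDeriv x ((hermiteExponent x ^ (m + 1)).coeff k) := by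
  have h := congrArg (Polynomial.coeff · k)
    ((timeAddDirDeriv x).leibniz_pow (hermiteExponent x) (m + 1))
  simp only [coeff_timeAddDirDeriv, timeAddDirDeriv_hermiteExponent, Nat.add_sub_cancel,
    smul_eq_mul, Polynomial.coeff_smul, Polynomial.coeff_mul_C] at h
  rw [nsmul_eq_mul, Nat.cast_succ] at h
  simp only [smul_eq_C_mul, map_add, map_mul, map_natCast, map_one, map_ofNat]
  linear_combination h

variable {K : Type*} [Field K]

/-- The coefficient of `tᵏ` in `exp (2⟨y, x⟩ t - (x · x) t²)`, as a polynomial in `y`. -/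
def hermite (x : σ → K) (k : ℕ) : MvPolynomial σ K :=
  ∑ m ∈ range (k + 1), (m.factorial : K)⁻¹ • (hermiteExponent x ^ m).coeff k

theorem hermite_zero (x : σ → K) : hermite x 0 = 1 := by simp [hermite]

variable [CharZero K]

theorem hermite_succ (x : σ → K) (k : ℕ) :
    (k + 1 : K) • hermite x (k + 1) =
      (2 : K) • (linearForm x * hermite x k) - dirDeriv x (hermite x k) := by
  have hderiv : dirDeriv x (hermite x k) = ∑ m ∈ range (k + 1),
      ((m + 1).factorial : K)⁻¹ • dirDeriv x ((hermiteExponent x ^ (m + 1)).coeff k) := by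
    rw [hermite, map_sum, sum_range_succ', sum_range_succ,
      coeff_hermiteExponent_pow_eq_zero x k.lt_succ_self]
    simp [Polynomial.coeff_one, apply_ite]
  have hterm (m : ℕ) : (k + 1 : K) • ((m + 1).factorial : K)⁻¹ •
        (hermiteExponent x ^ (m + 1)).coeff (k + 1) =
      (2 : K) • (m.factorial : K)⁻¹ • (linearForm x * (hermiteExponent x ^ m).coeff k) -
        ((m + 1).factorial : K)⁻¹ • dirDeriv x ((hermiteExponent x ^ (m + 1)).coeff k) := by
    have hfactorial : (m.factorial : K)⁻¹ = (m + 1) * ((m + 1).factorial : K)⁻¹ := by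
      rw [Nat.factorial_succ, Nat.cast_mul, Nat.cast_succ, mul_inv,
        mul_inv_cancel_left₀ m.cast_add_one_ne_zero]
    rw [smul_comm, coeff_succ_hermiteExponent_pow_succ, hfactorial]
    module
  rw [hderiv, hermite, hermite, sum_range_succ', pow_zero, Polynomial.coeff_one,
    if_neg k.succ_ne_zero, smul_zero, add_zero, smul_sum, mul_sum, smul_sum, ← sum_sub_distrib]
  exact sum_congr rfl fun m _ => by rw [hterm, mul_smul_comm]

theorem apply_hermite_mul (E : MvPolynomial σ K →ₗ[K] K) (x : σ → K)
    (hE : ∀ p, 2 * E (linearForm x * p) = E (dirDeriv x p)) {p : MvPolynomial σ K} {k : ℕ}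
    (hp : p.IsHomogeneous k) : E (hermite x k * p) = eval x p * E 1 := by
  induction k generalizing p with
  | zero =>
    obtain ⟨c, rfl⟩ : ∃ c, p = C c :=
      ⟨_, totalDegree_eq_zero_iff_eq_C.1 (hp.totalDegree_le.antisymm zero_le)⟩
    rw [hermite_zero, one_mul, eval_C, C_eq_smul_one, map_smul, smul_eq_mul]
  | succ k ih =>
    have hk : (k + 1 : K) ≠ 0 := k.cast_add_one_ne_zero
    have hrec : (k + 1 : K) * E (hermite x (k + 1) * p) = E (hermite x k * dirDeriv x p) := by
      have h := hE (hermite x k * p)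
      rw [Derivation.leibniz, map_add, smul_eq_mul, smul_eq_mul] at h
      rw [← smul_eq_mul, ← map_smul, ← smul_mul_assoc, hermite_succ, sub_mul, smul_mul_assoc,
        map_sub, map_smul, smul_eq_mul, mul_assoc, h, mul_comm p]
      ring
    rw [ih (dirDeriv_isHomogeneous x hp), eval_dirDeriv_self x hp, Nat.cast_succ, mul_assoc] at hrec
    exact mul_left_cancel₀ hk hrec

end Hermite

section Gaussian

open MvPolynomial

variable {ι : Type*}

theorem eval_mul_of_isHomogeneous {R : Type*} [CommSemiring R] {p : MvPolynomial ι R} {k : ℕ}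
    (hp : p.IsHomogeneous k) (c : R) (v : ι → R) :
    eval (fun j => c * v j) p = c ^ k * eval v p := by
  rw [eval_eq, eval_eq, Finset.mul_sum]
  refine Finset.sum_congr rfl fun d hd => ?_
  rw [Finset.prod_congr rfl fun i _ => mul_pow c (v i) (d i), Finset.prod_mul_distrib,
    Finset.prod_pow_eq_pow_sum, hp.degree_eq_sum_deg_support hd, mul_left_comm]

/-- The value of a polynomial with complex coefficients at a real vector. -/
def evalReal (p : MvPolynomial ι ℂ) (y : EuclideanSpace ℝ ι) : ℂ := eval (fun j => (y j : ℂ)) p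

theorem continuous_evalReal (p : MvPolynomial ι ℂ) : Continuous (evalReal p) :=
  p.continuous_eval.comp (by fun_prop)

theorem evalReal_mul (p q : MvPolynomial ι ℂ) (y : EuclideanSpace ℝ ι) :
    evalReal (p * q) y = evalReal p y * evalReal q y :=
  map_mul _ p q

theorem evalReal_smul_of_isHomogeneous {p : MvPolynomial ι ℂ} {k : ℕ} (hp : p.IsHomogeneous k)
    (r : ℝ) (y : EuclideanSpace ℝ ι) : evalReal p (r • y) = (r : ℂ) ^ k * evalReal p y := by
  simpa [evalReal] using eval_mul_of_isHomogeneous hp (r : ℂ) fun j => (y j : ℂ)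

variable [Fintype ι]

theorem norm_evalReal_monomial_le (s : ι →₀ ℕ) (c : ℂ) (y : EuclideanSpace ℝ ι) :
    ‖evalReal (monomial s c) y‖ ≤ ‖c‖ * ‖y‖ ^ s.degree := by
  rw [evalReal, eval_monomial, norm_mul, Finsupp.prod, norm_prod, Finsupp.degree_apply,
    ← Finset.prod_pow_eq_pow_sum]
  gcongr with j
  rw [norm_pow, Complex.norm_real]
  gcongr
  exact PiLp.norm_apply_le y j

theorem hasLineDerivAt_evalReal (p : MvPolynomial ι ℂ) (v y : EuclideanSpace ℝ ι) :
    HasLineDerivAt ℝ (evalReal p) (evalReal (dirDeriv (fun j => (v j : ℂ)) p) y) y v := by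
  unfold HasLineDerivAt
  induction p using MvPolynomial.induction_on with
  | C a => simpa [evalReal] using hasDerivAt_const (0 : ℝ) a
  | add p q hp hq => simpa [evalReal, Pi.add_def] using! hp.add hq
  | mul_X p j hp =>
    have hcoord : HasDerivAt (fun t : ℝ => (((y + t • v) j : ℝ) : ℂ)) (v j) 0 := by
      simpa using (((hasDerivAt_id (0 : ℝ)).mul_const (v j)).const_add (y j)).ofReal_comp
    simpa [evalReal, Pi.mul_def, dirDeriv_X, Derivation.leibniz, mul_comm, add_comm]
      using! hp.mul hcoord

theorem hasLineDerivAt_exp_neg_norm_sq {E : Type*} [NormedAddCommGroup E] [InnerProductSpace ℝ E]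
    (v y : E) : HasLineDerivAt ℝ (fun y : E => (Real.exp (-‖y‖ ^ 2) : ℂ))
      (-(2 * (inner ℝ y v : ℝ)) * Real.exp (-‖y‖ ^ 2)) y v := by
  have h := ((hasStrictFDerivAt_norm_sq y).hasFDerivAt.neg.exp.hasLineDerivAt v).ofReal_comp
  simpa [HasLineDerivAt, mul_comm] using! h

theorem norm_pow_mul_exp_neg_norm_sq_le {E : Type*} [NormedAddCommGroup E] (d : ℕ) (y : E) :
    ‖y‖ ^ d * Real.exp (-‖y‖ ^ 2) ≤
      d.factorial * Real.exp (1 / 2) * Real.exp (-(1 / 2) * ‖y‖ ^ 2) := by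
  have hpow : ‖y‖ ^ d ≤ d.factorial * Real.exp ‖y‖ := by
    rw [← div_le_iff₀' (by positivity)]
    exact Real.pow_div_factorial_le_exp _ (norm_nonneg y) d
  calc ‖y‖ ^ d * Real.exp (-‖y‖ ^ 2)
      ≤ d.factorial * Real.exp ‖y‖ * Real.exp (-‖y‖ ^ 2) := by gcongr
    _ = d.factorial * Real.exp (‖y‖ - ‖y‖ ^ 2) := by rw [mul_assoc, ← Real.exp_add, sub_eq_add_neg]
    _ ≤ d.factorial * Real.exp (1 / 2 + -(1 / 2) * ‖y‖ ^ 2) := by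
      gcongr
      linarith [sq_nonneg (‖y‖ - 1)]
    _ = _ := by rw [Real.exp_add, mul_assoc]

theorem integrable_norm_pow_mul_exp_neg_norm_sq {E : Type*} [NormedAddCommGroup E]
    [InnerProductSpace ℝ E] [FiniteDimensional ℝ E] [MeasurableSpace E] [BorelSpace E] (d : ℕ) :
    Integrable fun y : E => ‖y‖ ^ d * Real.exp (-‖y‖ ^ 2) := by
  have hgauss : Integrable fun y : E => Real.exp (-(1 / 2) * ‖y‖ ^ 2) := by
    have h := (GaussianFourier.integrable_cexp_neg_mul_sq_norm_add (V := E) (b := 1 / 2)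
      (by norm_num) 0 0).norm
    simpa [Complex.norm_exp, ← Complex.ofReal_pow] using h
  refine (hgauss.const_mul (d.factorial * Real.exp (1 / 2))).mono'
    (Continuous.aestronglyMeasurable (by fun_prop)) (.of_forall fun y => ?_)
  rw [Real.norm_of_nonneg (by positivity)]
  exact norm_pow_mul_exp_neg_norm_sq_le d y

theorem integrable_evalReal_mul_exp_neg_norm_sq (p : MvPolynomial ι ℂ) :
    Integrable fun y : EuclideanSpace ℝ ι => evalReal p y * (Real.exp (-‖y‖ ^ 2) : ℂ) := by
  induction p using MvPolynomial.induction_on' with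
  | monomial s c =>
    refine ((integrable_norm_pow_mul_exp_neg_norm_sq s.degree).const_mul ‖c‖).mono'
      ((continuous_evalReal _).mul (by fun_prop)).aestronglyMeasurable (.of_forall fun y => ?_)
    rw [norm_mul, Complex.norm_real, Real.norm_of_nonneg (Real.exp_pos _).le, ← mul_assoc]
    gcongr
    exact norm_evalReal_monomial_le s c y
  | add p q hp hq => simpa [evalReal, add_mul, Pi.add_def] using! hp.add hq

/-- The functional `p ↦ ∫ p(y) exp (-‖y‖²) dy`, not normalized to take the value `1` at `1`. -/
def gaussianIntegral : MvPolynomial ι ℂ →ₗ[ℂ] ℂ where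
  toFun p := ∫ y : EuclideanSpace ℝ ι, evalReal p y * (Real.exp (-‖y‖ ^ 2) : ℂ)
  map_add' p q := by
    rw [← integral_add (integrable_evalReal_mul_exp_neg_norm_sq p)
      (integrable_evalReal_mul_exp_neg_norm_sq q)]
    simp only [evalReal, map_add, add_mul]
  map_smul' c p := by
    rw [RingHom.id_apply, smul_eq_mul, ← integral_const_mul]
    simp only [evalReal, smul_eval, mul_assoc]

theorem gaussianIntegral_apply (p : MvPolynomial ι ℂ) : gaussianIntegral p =
    ∫ y : EuclideanSpace ℝ ι, evalReal p y * (Real.exp (-‖y‖ ^ 2) : ℂ) := rfl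

theorem gaussianIntegral_one_ne_zero : gaussianIntegral (1 : MvPolynomial ι ℂ) ≠ 0 := by
  have h := GaussianFourier.integral_rexp_neg_mul_sq_norm (V := EuclideanSpace ℝ ι) one_pos
  simp only [neg_one_mul] at h
  simp only [gaussianIntegral_apply, evalReal, map_one, one_mul]
  rw [integral_complex_ofReal, h, Complex.ofReal_ne_zero]
  positivity

theorem two_mul_gaussianIntegral_linearForm_mul_ofReal (v : EuclideanSpace ℝ ι)
    (p : MvPolynomial ι ℂ) :
    2 * gaussianIntegral (linearForm (fun j => (v j : ℂ)) * p) =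
      gaussianIntegral (dirDeriv (fun j => (v j : ℂ)) p) := by
  have hinner (y : EuclideanSpace ℝ ι) :
      evalReal (linearForm fun j => (v j : ℂ)) y = (inner ℝ y v : ℝ) := by
    simp [evalReal, linearForm, PiLp.inner_apply]
  have hweight (y : EuclideanSpace ℝ ι) :
      evalReal p y * (-(2 * (inner ℝ y v : ℝ)) * (Real.exp (-‖y‖ ^ 2) : ℂ)) =
        -2 * (evalReal (linearForm (fun j => (v j : ℂ)) * p) y * (Real.exp (-‖y‖ ^ 2) : ℂ)) := by
    rw [evalReal_mul, hinner]
    ring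
  have hparts := integral_bilinear_hasLineDerivAt_right_eq_neg_left_of_integrable
    (μ := (volume : Measure (EuclideanSpace ℝ ι))) (B := ContinuousLinearMap.mul ℝ ℂ)
    (integrable_evalReal_mul_exp_neg_norm_sq (dirDeriv (fun j => (v j : ℂ)) p))
    (by
      simp only [ContinuousLinearMap.mul_apply', hweight]
      exact (integrable_evalReal_mul_exp_neg_norm_sq _).const_mul _)
    (integrable_evalReal_mul_exp_neg_norm_sq p)
    (fun y _ => hasLineDerivAt_evalReal p v y) (fun y _ => hasLineDerivAt_exp_neg_norm_sq v y)
  simp only [ContinuousLinearMap.mul_apply', hweight, integral_const_mul,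
    ← gaussianIntegral_apply] at hparts
  linear_combination -hparts

theorem two_mul_gaussianIntegral_linearForm_mul (x : ι → ℂ) (p : MvPolynomial ι ℂ) :
    2 * gaussianIntegral (linearForm x * p) = gaussianIntegral (dirDeriv x p) := by
  have hsum (f : ι → MvPolynomial ι ℂ) : ∑ j, C (x j) * f j =
      ∑ j, C ((x j).re : ℂ) * f j + Complex.I • ∑ j, C ((x j).im : ℂ) * f j := by
    rw [Finset.smul_sum, ← Finset.sum_add_distrib]
    refine Finset.sum_congr rfl fun j _ => ?_
    conv_lhs => rw [← Complex.re_add_im (x j), mul_comm _ Complex.I]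
    rw [C_add, C_mul, smul_eq_C_mul]
    ring
  have hre := two_mul_gaussianIntegral_linearForm_mul_ofReal (WithLp.toLp 2 fun j => (x j).re) p
  have him := two_mul_gaussianIntegral_linearForm_mul_ofReal (WithLp.toLp 2 fun j => (x j).im) p
  simp only [linearForm, dirDeriv_apply] at hre him ⊢
  rw [hsum, hsum, add_mul, smul_mul_assoc]
  simp only [map_add, map_smul, smul_eq_mul]
  linear_combination hre + Complex.I * him

end Gaussian

section Sphere

open MvPolynomial

theorem integral_eq_integral_toSphere_prod_volumeIoiPow {E F : Type*} [NormedAddCommGroup E]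
    [NormedSpace ℝ E] [FiniteDimensional ℝ E] [Nontrivial E] [MeasurableSpace E] [BorelSpace E]
    [NormedAddCommGroup F] [NormedSpace ℝ F] (μ : Measure E) [μ.IsAddHaarMeasure] (f : E → F) :
    ∫ y, f y ∂μ = ∫ z : Metric.sphere (0 : E) 1 × Set.Ioi (0 : ℝ), f (z.2.1 • z.1.1)
      ∂μ.toSphere.prod (.volumeIoiPow (Module.finrank ℝ E - 1)) := by
  calc ∫ y, f y ∂μ = ∫ y : ({(0)}ᶜ : Set E), f y.1 ∂(μ.comap (↑)) := by
        rw [integral_subtype_comap (measurableSet_singleton _).compl, restrict_compl_singleton]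
    _ = _ := by
        rw [← μ.measurePreserving_homeomorphUnitSphereProd.integral_comp
          (Homeomorph.measurableEmbedding _)]
        refine integral_congr_ae (.of_forall fun y => ?_)
        simp [smul_inv_smul₀ (norm_ne_zero_iff.2 y.2)]

theorem integral_volumeIoiPow {F : Type*} [NormedAddCommGroup F] [NormedSpace ℝ F] (d : ℕ)
    (f : ℝ → F) :
    ∫ r : Set.Ioi (0 : ℝ), f r ∂.volumeIoiPow d = ∫ r in Set.Ioi (0 : ℝ), r ^ d • f r := by
  simp only [Measure.volumeIoiPow, ENNReal.ofReal]
  rw [integral_withDensity_eq_integral_smul (measurable_subtype_coe.pow_const d).real_toNNReal,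
    integral_subtype_comap measurableSet_Ioi fun r : ℝ => Real.toNNReal (r ^ d) • f r]
  refine setIntegral_congr_fun measurableSet_Ioi fun r hr => ?_
  rw [NNReal.smul_def, Real.coe_toNNReal _ (pow_nonneg (Set.mem_Ioi.1 hr).le d)]

theorem integral_homogeneous_mul_norm {E : Type*} [NormedAddCommGroup E] [NormedSpace ℝ E]
    [FiniteDimensional ℝ E] [Nontrivial E] [MeasurableSpace E] [BorelSpace E] (μ : Measure E)
    [μ.IsAddHaarMeasure] {f : E → ℂ} (g : ℝ → ℂ) {d : ℕ}
    (hf : ∀ (r : ℝ) (y : E), f (r • y) = (r : ℂ) ^ d * f y) :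
    ∫ y, f y * g ‖y‖ ∂μ = (∫ θ, f θ.1 ∂μ.toSphere) *
      ∫ r in Set.Ioi (0 : ℝ), (r : ℂ) ^ (Module.finrank ℝ E - 1 + d) * g r := by
  have hpolar (z : Metric.sphere (0 : E) 1 × Set.Ioi (0 : ℝ)) :
      f (z.2.1 • z.1.1) * g ‖z.2.1 • z.1.1‖ = f z.1.1 * ((z.2.1 : ℂ) ^ d * g z.2.1) := by
    rw [hf, norm_smul, norm_eq_of_mem_sphere, mul_one, Real.norm_of_nonneg z.2.2.le]
    ring
  rw [integral_eq_integral_toSphere_prod_volumeIoiPow, funext hpolar,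
    integral_prod_mul (fun θ : Metric.sphere (0 : E) 1 => f θ.1)
      fun r : Set.Ioi (0 : ℝ) => (r.1 : ℂ) ^ d * g r,
    integral_volumeIoiPow _ fun r : ℝ => (r : ℂ) ^ d * g r]
  simp only [Complex.real_smul, Complex.ofReal_pow, pow_add, mul_assoc]

theorem integral_Ioi_pow_mul_exp_neg_sq (d : ℕ) :
    ∫ r in Set.Ioi (0 : ℝ), (r : ℂ) ^ d * (Real.exp (-r ^ 2) : ℂ) =
      1 / 2 * Complex.Gamma ((d + 1) / 2) := by
  have h := integral_rpow_mul_exp_neg_rpow (p := 2) (q := d) two_pos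
    (neg_one_lt_zero.trans_le d.cast_nonneg)
  simp only [Real.rpow_natCast, Real.rpow_two] at h
  simp only [← Complex.ofReal_pow, ← Complex.ofReal_mul]
  rw [integral_complex_ofReal, h]
  push_cast [← Complex.Gamma_ofReal]
  rfl

theorem Gamma_add_natCast_eq_choose_mul {a : ℂ} (ha : 0 < a.re) (m : ℕ) :
    Complex.Gamma (a + m) = m.factorial * Ring.choose (a + m - 1) m * Complex.Gamma a := by
  have ha' (k : ℕ) : a ≠ -k := by
    rintro rfl
    simp only [Complex.neg_re, Complex.natCast_re] at ha
    linarith [k.cast_nonneg (α := ℝ)]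
  rw [← Ring.multichoose_eq, ← nsmul_eq_mul, Ring.factorial_nsmul_multichoose_eq_ascPochhammer,
    Polynomial.ascPochhammer_smeval_eq_eval, ← Complex.Gamma_add_nat_div_Gamma_eq a ha',
    div_mul_cancel₀ _ (Complex.Gamma_ne_zero ha')]

variable {ι : Type*} [Fintype ι]

theorem integrable_toSphere_evalReal (p : MvPolynomial ι ℂ) :
    Integrable (fun θ : Metric.sphere (0 : EuclideanSpace ℝ ι) 1 => evalReal p θ.1)
      (volume : Measure (EuclideanSpace ℝ ι)).toSphere :=
  ((continuous_evalReal p).comp continuous_subtype_val).integrable_of_hasCompactSupport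
    (HasCompactSupport.of_compactSpace _)

variable [Nonempty ι]

theorem gaussianIntegral_eq_integral_toSphere {p : MvPolynomial ι ℂ} {m : ℕ}
    (hp : ∀ (r : ℝ) (y : EuclideanSpace ℝ ι),
      evalReal p (r • y) = (r : ℂ) ^ (2 * m) * evalReal p y) :
    gaussianIntegral p =
      (∫ θ, evalReal p θ.1 ∂(volume : Measure (EuclideanSpace ℝ ι)).toSphere) *
        (1 / 2 * Complex.Gamma (Fintype.card ι / 2 + m)) := by
  have hcard : ((Fintype.card ι - 1 : ℕ) : ℂ) = Fintype.card ι - 1 :=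
    Nat.cast_pred Fintype.card_pos
  rw [gaussianIntegral_apply, integral_homogeneous_mul_norm volume
    (fun r => (Real.exp (-r ^ 2) : ℂ)) hp, integral_Ioi_pow_mul_exp_neg_sq, finrank_euclideanSpace]
  push_cast [hcard]
  ring_nf

theorem gaussianIntegral_eq_average {p : MvPolynomial ι ℂ} {m : ℕ}
    (hp : ∀ (r : ℝ) (y : EuclideanSpace ℝ ι),
      evalReal p (r • y) = (r : ℂ) ^ (2 * m) * evalReal p y) :
    gaussianIntegral p = m.factorial * Ring.choose ((Fintype.card ι : ℂ) / 2 + m - 1) m *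
      (⨍ θ, evalReal p θ.1 ∂(volume : Measure (EuclideanSpace ℝ ι)).toSphere) *
      gaussianIntegral (1 : MvPolynomial ι ℂ) := by
  have hone := gaussianIntegral_eq_integral_toSphere (ι := ι) (p := 1) (m := 0)
    (by simp [evalReal])
  simp only [evalReal, map_one, integral_const, Complex.real_smul, mul_one, Nat.cast_zero,
    add_zero] at hone
  have hcard : 0 < ((Fintype.card ι : ℂ) / 2).re := by
    simpa using Fintype.card_pos (α := ι)
  rw [gaussianIntegral_eq_integral_toSphere hp, hone, Gamma_add_natCast_eq_choose_mul hcard,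
    ← measure_smul_average, Complex.real_smul]
  ring

theorem factorial_inv_mul_gaussianIntegral_coeff_hermiteExponent_pow_mul (x : ι → ℂ)
    {p : MvPolynomial ι ℂ} {k : ℕ} (hp : p.IsHomogeneous k) (m : ℕ) :
    (m.factorial : ℂ)⁻¹ * gaussianIntegral ((hermiteExponent x ^ m).coeff k * p) =
      Ring.choose ((Fintype.card ι : ℂ) / 2 + m - 1) m *
        (⨍ θ, evalReal ((hermiteExponent x ^ m).coeff k * p) θ.1
          ∂(volume : Measure (EuclideanSpace ℝ ι)).toSphere) *
        gaussianIntegral (1 : MvPolynomial ι ℂ) := by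
  have hm : (m.factorial : ℂ) ≠ 0 := Nat.cast_ne_zero.2 m.factorial_ne_zero
  rw [gaussianIntegral_eq_average (m := m), mul_assoc, mul_assoc, inv_mul_cancel_left₀ hm,
    mul_assoc]
  intro r y
  have hscale : (r : ℂ) ^ k * evalReal ((hermiteExponent x ^ m).coeff k) (r • y) =
      (r : ℂ) ^ (2 * m) * evalReal ((hermiteExponent x ^ m).coeff k) y := by
    simpa [evalReal] using
      pow_mul_eval_mul_coeff_hermiteExponent_pow x (fun j => (y j : ℂ)) (r : ℂ) m k
  rw [evalReal_mul, evalReal_mul, evalReal_smul_of_isHomogeneous hp]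
  linear_combination evalReal p y * hscale

theorem average_gegenbauer_mul (x : ι → ℂ) {p : MvPolynomial ι ℂ} {k : ℕ}
    (hp : p.IsHomogeneous k) :
    ⨍ θ, evalReal (gegenbauer ((Fintype.card ι : ℂ) / 2) x k * p) θ.1
      ∂(volume : Measure (EuclideanSpace ℝ ι)).toSphere = eval x p := by
  have hgauss := apply_hermite_mul gaussianIntegral x
    (two_mul_gaussianIntegral_linearForm_mul x) hp
  rw [hermite, Finset.sum_mul, map_sum] at hgauss
  simp only [smul_mul_assoc, map_smul, smul_eq_mul,
    factorial_inv_mul_gaussianIntegral_coeff_hermiteExponent_pow_mul x hp, ← Finset.sum_mul]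
    at hgauss
  rw [← mul_right_cancel₀ gaussianIntegral_one_ne_zero hgauss]
  have hexpand (θ : Metric.sphere (0 : EuclideanSpace ℝ ι) 1) :
      evalReal (gegenbauer ((Fintype.card ι : ℂ) / 2) x k * p) θ.1 =
        ∑ m ∈ Finset.range (k + 1), Ring.choose ((Fintype.card ι : ℂ) / 2 + m - 1) m *
          evalReal ((hermiteExponent x ^ m).coeff k * p) θ.1 := by
    simp only [gegenbauer, evalReal, Finset.sum_mul, map_sum, smul_mul_assoc, smul_eval]
  simp only [hexpand, average]
  rw [integral_finsetSum _ fun m _ => (integrable_toSphere_evalReal _).to_average.const_mul _]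
  simp only [integral_const_mul]

end Sphere

section CircleIntegral

open Filter Topology Asymptotics

theorem circleIntegral_eq_zero_of_isLittleO_inv {E : Type*} [NormedAddCommGroup E]
    [NormedSpace ℂ E] {f : ℂ → E} {L R : ℝ} (hR : 0 < R) (hLR : L < R)
    (hf : ∀ ζ, L < ‖ζ‖ → DifferentiableAt ℂ f ζ)
    (hdecay : f =o[Bornology.cobounded ℂ] fun ζ => ζ⁻¹) :
    (∮ ζ in C(0, R), f ζ) = 0 := by
  have hannulus {S : ℝ} (hS : R ≤ S) : (∮ ζ in C(0, S), f ζ) = ∮ ζ in C(0, R), f ζ := by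
    have hdiff (ζ : ℂ) (hζ : ζ ∉ Metric.ball 0 R) : DifferentiableAt ℂ f ζ := by
      rw [mem_ball_zero_iff, not_lt] at hζ
      exact hf ζ (hLR.trans_le hζ)
    exact Complex.circleIntegral_eq_of_differentiable_on_annulus_off_countable hR hS
      Set.countable_empty (fun ζ hζ => (hdiff ζ hζ.2).continuousAt.continuousWithinAt)
      fun ζ hζ => hdiff ζ fun h => hζ.1.2 (Metric.ball_subset_closedBall h)
  refine norm_le_zero_iff.1 (le_of_forall_pos_le_add fun ε hε => ?_)
  obtain ⟨S₀, -, hS₀⟩ := (hasBasis_cobounded_norm.eventually_iff).1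
    (hdecay.def (c := ε / (2 * Real.pi)) (by positivity))
  set S := max R S₀
  have hS : 0 < S := hR.trans_le (le_max_left R S₀)
  calc ‖∮ ζ in C(0, R), f ζ‖ = ‖∮ ζ in C(0, S), f ζ‖ := by rw [hannulus (le_max_left R S₀)]
    _ ≤ 2 * Real.pi * S * (ε / (2 * Real.pi) * S⁻¹) := by
      refine circleIntegral.norm_integral_le_of_norm_le_const hS.le fun ζ hζ => ?_
      rw [mem_sphere_zero_iff_norm] at hζ
      simpa [hζ] using hS₀ ((le_max_right R S₀).trans_eq hζ.symm)
    _ = 0 + ε := by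
      field_simp
      rw [zero_add]

theorem circleIntegrable_pow_mul_inv_mul_eval_inv (p : Polynomial ℂ) (k : ℕ) {R : ℝ} (hR : 0 < R) :
    CircleIntegrable (fun ζ => ζ ^ k * (ζ⁻¹ * p.eval ζ⁻¹)) 0 R := by
  refine ContinuousOn.circleIntegrable hR.le ?_
  have h : ContinuousOn (fun ζ : ℂ => ζ⁻¹) (Metric.sphere 0 R) :=
    continuousOn_inv₀.mono fun ζ hζ => ne_zero_of_mem_sphere hR.ne' ⟨ζ, hζ⟩
  exact (continuous_pow k).continuousOn.mul (h.mul (p.continuous.comp_continuousOn h))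

theorem circleIntegral_pow_mul_inv_mul_eval_inv (p : Polynomial ℂ) (k : ℕ) {R : ℝ} (hR : 0 < R) :
    (∮ ζ in C(0, R), ζ ^ k * (ζ⁻¹ * p.eval ζ⁻¹)) = 2 * Real.pi * Complex.I * p.coeff k := by
  induction p using Polynomial.induction_on' with
  | add p q hp hq =>
    simp only [Polynomial.eval_add, mul_add, Polynomial.coeff_add]
    rw [circleIntegral.integral_add (circleIntegrable_pow_mul_inv_mul_eval_inv p k hR)
      (circleIntegrable_pow_mul_inv_mul_eval_inv q k hR), hp, hq]
  | monomial j a =>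
    have hzpow : (∮ ζ in C(0, R), ζ ^ k * (ζ⁻¹ * (Polynomial.monomial j a).eval ζ⁻¹)) =
        ∮ ζ in C(0, R), a * (ζ - 0) ^ ((k : ℤ) - 1 - j) := by
      refine circleIntegral.integral_congr hR.le fun ζ hζ => ?_
      have hζ0 : ζ ≠ 0 := ne_zero_of_mem_sphere hR.ne' ⟨ζ, hζ⟩
      simp only [Polynomial.eval_monomial, sub_zero, zpow_sub₀ hζ0, zpow_natCast, zpow_one, inv_pow]
      field_simp
    rw [hzpow, circleIntegral.integral_const_mul, Polynomial.coeff_monomial]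
    split_ifs with hjk
    · subst hjk
      have hinv : (∮ ζ in C(0, R), (ζ - 0) ^ ((j : ℤ) - 1 - j)) = 2 * Real.pi * Complex.I := by
        simpa using circleIntegral.integral_sub_center_inv 0 hR.ne'
      rw [hinv, mul_comm]
    · rw [circleIntegral.integral_sub_zpow_of_ne (by lia), mul_zero, mul_zero]

theorem circleIntegral_pow_mul_inv_mul_comp_inv {f : ℂ → ℂ} {p : Polynomial ℂ} {k : ℕ} {L R : ℝ}
    (hL : 0 ≤ L) (hLR : L < R) (hf : ∀ ζ, L < ‖ζ‖ → DifferentiableAt ℂ (fun ζ => f ζ⁻¹) ζ)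
    (hfp : (fun w => f w - p.eval w) =o[𝓝 0] fun w => w ^ k) :
    (∮ ζ in C(0, R), ζ ^ k * (ζ⁻¹ * f ζ⁻¹)) = 2 * Real.pi * Complex.I * p.coeff k := by
  have hR : 0 < R := hL.trans_lt hLR
  have hdiff {g : ℂ → ℂ} {ζ : ℂ} (hζ : L < ‖ζ‖) (hg : DifferentiableAt ℂ (fun ζ => g ζ⁻¹) ζ) :
      DifferentiableAt ℂ (fun ζ => ζ ^ k * (ζ⁻¹ * g ζ⁻¹)) ζ :=
    (differentiableAt_pow k).mul ((differentiableAt_inv (norm_pos_iff.1 (hL.trans_lt hζ))).mul hg)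
  have hfint : CircleIntegrable (fun ζ => ζ ^ k * (ζ⁻¹ * f ζ⁻¹)) 0 R := by
    refine ContinuousOn.circleIntegrable hR.le fun ζ hζ => ?_
    have hζL : L < ‖ζ‖ := hLR.trans_eq (mem_sphere_zero_iff_norm.1 hζ).symm
    exact (hdiff hζL (hf ζ hζL)).continuousAt.continuousWithinAt
  rw [← circleIntegral_pow_mul_inv_mul_eval_inv p k hR, ← sub_eq_zero,
    ← circleIntegral.integral_sub hfint (circleIntegrable_pow_mul_inv_mul_eval_inv p k hR)]
  refine circleIntegral_eq_zero_of_isLittleO_inv hR hLR (fun ζ hζ => ?_) ?_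
  · have hp : DifferentiableAt ℂ (fun ζ : ℂ => p.eval ζ⁻¹) ζ :=
      p.differentiableAt.comp ζ (differentiableAt_inv (norm_pos_iff.1 (hL.trans_lt hζ)))
    exact (hdiff hζ (hf ζ hζ)).sub (hdiff (g := fun w => p.eval w) hζ hp)
  · have hdecay := hfp.comp_tendsto (tendsto_inv₀_cobounded (α := ℂ))
    refine ((isBigO_refl (fun ζ : ℂ => ζ ^ k * ζ⁻¹) _).mul_isLittleO hdecay).congr' ?_ ?_
    · exact .of_forall fun ζ => by simp only [Function.comp_apply]; ring
    · filter_upwards [Bornology.eventually_ne_cobounded (0 : ℂ)] with ζ hζ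
      simp only [Function.comp_apply, inv_pow]
      field_simp

theorem isLittleO_one_div_one_sub_cpow_sub_eval (D : Polynomial ℂ) (hD : D.eval 0 = 0) (a : ℂ)
    (k : ℕ) :
    (fun w => 1 / (1 - D.eval w) ^ a -
      (∑ m ∈ Finset.range (k + 1), Polynomial.C (Ring.choose (a + m - 1) m) * D ^ m).eval w)
        =o[𝓝 0] fun w => w ^ k := by
  have hD0 : Tendsto (fun w => D.eval w) (𝓝 0) (𝓝 0) := by
    simpa only [hD] using D.continuous.tendsto (0 : ℂ)
  have hDO : (fun w => D.eval w) =O[𝓝 0] fun w => w := by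
    simpa only [hD, sub_zero] using (D.differentiableAt (x := (0 : ℂ))).isBigO_sub
  have hseries := ((Complex.one_div_one_sub_cpow_hasFPowerSeriesOnBall_zero
    a).hasFPowerSeriesAt.isBigO_sub_partialSum_pow (k + 1)).comp_tendsto hD0
  refine (IsBigO.trans_isLittleO ?_ (isLittleO_pow_pow k.lt_succ_self))
  refine (hseries.trans (hDO.norm_left.pow (k + 1))).congr_left fun w => ?_
  simp [FormalMultilinearSeries.partialSum, Polynomial.eval_finsetSum, mul_comm]

theorem circleIntegral_pow_mul_inv_mul_one_div_one_sub_cpow {D : Polynomial ℂ} (hD : D.eval 0 = 0)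
    (a : ℂ) {L R : ℝ} (hL : 0 ≤ L) (hLR : L < R)
    (hslit : ∀ ζ : ℂ, L < ‖ζ‖ → 1 - D.eval ζ⁻¹ ∈ Complex.slitPlane) (k : ℕ) :
    (∮ ζ in C(0, R), ζ ^ k * (ζ⁻¹ * (1 / (1 - D.eval ζ⁻¹) ^ a))) =
      2 * Real.pi * Complex.I *
        ∑ m ∈ Finset.range (k + 1), Ring.choose (a + m - 1) m * (D ^ m).coeff k := by
  have hdiff (ζ : ℂ) (hζ : L < ‖ζ‖) :
      DifferentiableAt ℂ (fun ζ => 1 / (1 - D.eval ζ⁻¹) ^ a) ζ := by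
    have hbase : DifferentiableAt ℂ (fun ζ : ℂ => 1 - D.eval ζ⁻¹) ζ :=
      (D.differentiableAt.comp ζ
        (differentiableAt_inv (norm_pos_iff.1 (hL.trans_lt hζ)))).const_sub 1
    refine (differentiableAt_const 1).div (hbase.cpow_const (hslit ζ hζ)) ?_
    rw [Ne, Complex.cpow_eq_zero_iff]
    exact fun h => Complex.slitPlane_ne_zero (hslit ζ hζ) h.1
  have h := circleIntegral_pow_mul_inv_mul_comp_inv hL hLR hdiff
    (isLittleO_one_div_one_sub_cpow_sub_eval D hD a k)
  simpa only [Polynomial.finsetSum_coeff, Polynomial.coeff_C_mul] using h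

theorem circleIntegral_average_comm {X : Type*} [TopologicalSpace X] [CompactSpace X]
    [MeasurableSpace X] [OpensMeasurableSpace X]
    {E : Type*} [NormedAddCommGroup E] [NormedSpace ℂ E]
    {μ : Measure X} [IsFiniteMeasure μ] {f : ℂ → X → E} {c : ℂ} {R : ℝ}
    (hf : Continuous fun p : ℝ × X => f (circleMap c R p.1) p.2) :
    (∮ ζ in C(c, R), ⨍ x, f ζ x ∂μ) = ⨍ x, (∮ ζ in C(c, R), f ζ x) ∂μ := by
  set g : ℝ → X → E := fun t x => deriv (circleMap c R) t • f (circleMap c R t) x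
  have hg : Continuous (Function.uncurry g) := by
    refine Continuous.smul ?_ hf
    simp only [deriv_circleMap]
    fun_prop
  have hint : Integrable (Function.uncurry g)
      ((volume.restrict (Set.uIoc 0 (2 * Real.pi))).prod μ) := by
    have h : IntegrableOn (Function.uncurry g) (Set.uIcc 0 (2 * Real.pi) ×ˢ Set.univ)
        (volume.prod μ) :=
      hg.continuousOn.integrableOn_compact' (isCompact_uIcc.prod isCompact_univ)
        (measurableSet_uIcc.prod .univ)
    rw [IntegrableOn, ← Measure.prod_restrict, Measure.restrict_univ] at h
    exact h.mono_measure
      (Measure.prod_mono (Measure.restrict_mono Set.uIoc_subset_uIcc le_rfl) le_rfl)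
  calc (∮ ζ in C(c, R), ⨍ x, f ζ x ∂μ)
      = (μ.real Set.univ)⁻¹ • ∫ t in 0..2 * Real.pi, ∫ x, g t x ∂μ := by
        rw [circleIntegral, ← intervalIntegral.integral_smul]
        refine intervalIntegral.integral_congr fun t _ => ?_
        simp only [average_eq, g, integral_smul]
        exact smul_comm _ _ _
    _ = ⨍ x, (∮ ζ in C(c, R), f ζ x) ∂μ := by
        rw [intervalIntegral_integral_swap hint, average_eq]
        rfl

end CircleIntegral

section CauchyFormula

open MvPolynomial

variable {n : ℕ} {x : EuclideanSpace ℂ (Fin n)} {R : ℝ}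

theorem eval_mul_ofReal_eq_sum (P : MvPolynomial (Fin n) ℂ) (ζ : ℂ)
    (y : EuclideanSpace ℝ (Fin n)) : eval (fun j => ζ * (y j : ℂ)) P =
      ∑ k ∈ Finset.range (P.totalDegree + 1), ζ ^ k * evalReal (homogeneousComponent k P) y := by
  conv_lhs => rw [← sum_homogeneousComponent P, map_sum]
  exact Finset.sum_congr rfl fun k _ =>
    eval_mul_of_isHomogeneous (homogeneousComponent_isHomogeneous k P) ζ _

theorem one_sub_eval_hermiteExponent_inv (x : EuclideanSpace ℂ (Fin n)) (θ : RealSphere n)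
    (ζ : ℂ) : 1 - ((hermiteExponent fun j => x j).map (eval fun j => (θ.1 j : ℂ))).eval ζ⁻¹ =
      1 - 2 * realPairing θ x / ζ + bilinSq x / ζ ^ 2 := by
  rw [map_eval_hermiteExponent]
  simp only [Polynomial.eval_sub, Polynomial.eval_mul, Polynomial.eval_C, Polynomial.eval_X,
    Polynomial.eval_pow, realPairing, bilinSq]
  ring

theorem continuousOn_huaAronszajnKernel (x : EuclideanSpace ℂ (Fin n)) :
    ContinuousOn (fun p : ℂ × RealSphere n => huaAronszajnKernel p.1 p.2 x)
      {p | lieNorm x < ‖p.1‖} := by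
  have hroot : ContinuousOn (fun p : ℂ × RealSphere n => aronszajnRoot p.1 p.2 x)
      {p | lieNorm x < ‖p.1‖} :=
    continuousOn_aronszajnRoot.comp (f := fun p : ℂ × RealSphere n => (p.1, p.2, x))
      (by fun_prop) fun p hp => hp
  exact (continuous_fst.pow _).continuousOn.div (hroot.pow n)
    fun p hp => pow_ne_zero n (aronszajnRoot_ne_zero p.2 hp)

theorem continuous_huaAronszajnKernel_mul_eval (P : MvPolynomial (Fin n) ℂ)
    (hR : lieNorm x < R) :
    Continuous fun p : ℝ × RealSphere n => huaAronszajnKernel (circleMap 0 R p.1) p.2 x *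
      eval (fun j => circleMap 0 R p.1 * (p.2.1 j : ℂ)) P := by
  refine Continuous.mul ?_ (P.continuous_eval.comp (by fun_prop))
  refine (continuousOn_huaAronszajnKernel x).comp_continuous
    (f := fun p : ℝ × RealSphere n => (circleMap 0 R p.1, p.2)) (by fun_prop) fun p => ?_
  rw [Set.mem_ofPred_eq, norm_circleMap_zero]
  exact hR.trans_le (le_abs_self R)

theorem circleIntegrable_pow_mul_huaAronszajnKernel (hR : lieNorm x < R) (θ : RealSphere n)
    (k : ℕ) : CircleIntegrable (fun ζ => ζ ^ k * huaAronszajnKernel ζ θ x) 0 R := by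
  have hRpos : 0 < R := (lieNorm_nonneg x).trans_lt hR
  refine ContinuousOn.circleIntegrable hRpos.le ((continuous_pow k).continuousOn.mul ?_)
  refine (continuousOn_huaAronszajnKernel x).comp (f := fun ζ : ℂ => (ζ, θ)) (by fun_prop)
    fun ζ hζ => ?_
  exact hR.trans_eq (mem_sphere_zero_iff_norm.1 hζ).symm

variable [NeZero n]

theorem circleIntegral_pow_mul_huaAronszajnKernel (hR : lieNorm x < R) (θ : RealSphere n)
    (k : ℕ) : (∮ ζ in C(0, R), ζ ^ k * huaAronszajnKernel ζ θ x) =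
      2 * Real.pi * Complex.I * evalReal (gegenbauer ((n : ℂ) / 2) (fun j => x j) k) θ.1 := by
  have hRpos : 0 < R := (lieNorm_nonneg x).trans_lt hR
  set D := (hermiteExponent fun j => x j).map (eval fun j => (θ.1 j : ℂ)) with hD
  have hD0 : D.eval 0 = 0 := by simp [hD, map_eval_hermiteExponent]
  have hslit (ζ : ℂ) (hζ : lieNorm x < ‖ζ‖) : 1 - D.eval ζ⁻¹ ∈ Complex.slitPlane := by
    rw [one_sub_eval_hermiteExponent_inv]
    exact radicand_mem_slitPlane θ hζ
  calc (∮ ζ in C(0, R), ζ ^ k * huaAronszajnKernel ζ θ x)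
      = ∮ ζ in C(0, R), ζ ^ k * (ζ⁻¹ * (1 / (1 - D.eval ζ⁻¹) ^ ((n : ℂ) / 2))) := by
        refine circleIntegral.integral_congr hRpos.le fun ζ hζ => ?_
        have hζ0 : ζ ≠ 0 := ne_zero_of_mem_sphere hRpos.ne' ⟨ζ, hζ⟩
        simp only [huaAronszajnKernel_eq_inv_mul_cpow hζ0, hD, one_sub_eval_hermiteExponent_inv]
    _ = _ := by
        rw [circleIntegral_pow_mul_inv_mul_one_div_one_sub_cpow hD0 _ (lieNorm_nonneg x) hR hslit]
        simp only [gegenbauer, evalReal, map_sum, smul_eval, eval_coeff_hermiteExponent_pow, hD]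

theorem circleIntegral_huaAronszajnKernel_mul_eval (P : MvPolynomial (Fin n) ℂ)
    (hR : lieNorm x < R) (θ : RealSphere n) :
    (∮ ζ in C(0, R), huaAronszajnKernel ζ θ x * eval (fun j => ζ * (θ.1 j : ℂ)) P) =
      2 * Real.pi * Complex.I * ∑ k ∈ Finset.range (P.totalDegree + 1),
        evalReal (gegenbauer ((n : ℂ) / 2) (fun j => x j) k * homogeneousComponent k P) θ.1 := by
  have hexpand (ζ : ℂ) : huaAronszajnKernel ζ θ x * eval (fun j => ζ * (θ.1 j : ℂ)) P =
      ∑ k ∈ Finset.range (P.totalDegree + 1), evalReal (homogeneousComponent k P) θ.1 *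
        (ζ ^ k * huaAronszajnKernel ζ θ x) := by
    rw [eval_mul_ofReal_eq_sum, Finset.mul_sum]
    exact Finset.sum_congr rfl fun k _ => by ring
  have hint (k : ℕ) : CircleIntegrable (fun ζ => evalReal (homogeneousComponent k P) θ.1 *
      (ζ ^ k * huaAronszajnKernel ζ θ x)) 0 R :=
    (circleIntegrable_pow_mul_huaAronszajnKernel hR θ k).const_smul
  simp only [hexpand]
  rw [circleIntegral.integral_fun_sum fun k _ => hint k, Finset.mul_sum]
  refine Finset.sum_congr rfl fun k _ => ?_
  rw [circleIntegral.integral_const_mul, circleIntegral_pow_mul_huaAronszajnKernel hR,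
    evalReal_mul]
  ring

theorem eval_eq_circleIntegral_average_huaAronszajnKernel (P : MvPolynomial (Fin n) ℂ)
    (hR : lieNorm x < R) :
    eval (fun j => x j) P = (2 * (Real.pi : ℂ) * Complex.I)⁻¹ *
      ∮ ζ in C(0, R), ⨍ θ : RealSphere n,
        huaAronszajnKernel ζ θ x * eval (fun j => ζ * (θ.1 j : ℂ)) P
          ∂((volume : Measure (EuclideanSpace ℝ (Fin n))).toSphere) := by
  have hreproduce (k : ℕ) :
      ⨍ θ : RealSphere n, evalReal (gegenbauer ((n : ℂ) / 2) (fun j => x j) k *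
          homogeneousComponent k P) θ.1 ∂(volume : Measure (EuclideanSpace ℝ (Fin n))).toSphere =
        eval (fun j => x j) (homogeneousComponent k P) := by
    simpa only [Fintype.card_fin] using
      average_gegenbauer_mul (fun j => x j) (homogeneousComponent_isHomogeneous k P)
  rw [circleIntegral_average_comm (continuous_huaAronszajnKernel_mul_eval P hR)]
  simp only [circleIntegral_huaAronszajnKernel_mul_eval P hR, average, integral_const_mul]
  rw [integral_finsetSum _ fun k _ => (integrable_toSphere_evalReal _).to_average,
    inv_mul_cancel_left₀ Complex.two_pi_I_ne_zero]
  conv_lhs => rw [← sum_homogeneousComponent P, map_sum]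
  exact Finset.sum_congr rfl fun k _ => (hreproduce k).symm

end CauchyFormula

end HuaAronszajn

end

theorem mainTheorem6 (n : ℕ) (hn : 2 ≤ n) :
    -- the root is a continuous branch without zeros wherever `L(x) < |ζ|`
    (ContinuousOn
        (fun p : ℂ × RealSphere n × EuclideanSpace ℂ (Fin n) =>
          aronszajnRoot p.1 p.2.1 p.2.2)
        {p | lieNorm p.2.2 < ‖p.1‖} ∧
      ∀ (ζ : ℂ) (θ : RealSphere n) (x : EuclideanSpace ℂ (Fin n)),
        lieNorm x < ‖ζ‖ → aronszajnRoot ζ θ x ≠ 0) ∧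
    -- the Cauchy formula; `⨍` integrates against the normalized surface measure
    ∀ (P : MvPolynomial (Fin n) ℂ) (x : EuclideanSpace ℂ (Fin n)) (R : ℝ), lieNorm x < R →
      MvPolynomial.eval (fun j => x j) P =
        (2 * (Real.pi : ℂ) * Complex.I)⁻¹ *
          ∮ ζ in C(0, R),
            ⨍ θ : RealSphere n,
              huaAronszajnKernel ζ θ x * MvPolynomial.eval (fun j => ζ * (θ.1 j : ℂ)) P
              ∂((volume : Measure (EuclideanSpace ℝ (Fin n))).toSphere) := by
  have : NeZero n := ⟨by lia⟩
  exact ⟨⟨HuaAronszajn.continuousOn_aronszajnRoot,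
      fun _ θ _ h => HuaAronszajn.aronszajnRoot_ne_zero θ h⟩,
    fun P _ _ hR => HuaAronszajn.eval_eq_circleIntegral_average_huaAronszajnKernel P hR⟩
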